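/- Let $k$ be a field, $S=k[x_1,x_2,x_3]$, let $(n_i)_{i}$ be a family of non-negative integers, and let $N=\bigoplus_i S/(x_1,x_2,x_3^{n_i})$. Let $I\subseteq K\subseteq S$ and $J\subseteq L\subseteq S$ be monomial ideals with $\dim_k S/I<\infty$ and $\dim_k S/J<\infty$, such that $K/I\simeq N$ as $S$-modules, and let $\phi\colon K/I\to L/J$ be an isomorphism of $S$-modules that sends (nonzero classes of) monomials to classes of monomials. Put \[ M=(S/I\oplus S/J)\big/\{(f,-\phi(f))\mid f\in K/I\}, \] let $d=\dim_k M$, and for $i=1,2,3$ let $A_i$ be the $d\times d$ matrix of the multiplication map $M\xrightarrow{\cdot x_i}M$ with respect to the natural monomial basis of $M$ (the nonzero classes of the elements $(x^a,0)$ and $(0,x^a)$, in any order). Then the unital $k$-algebra $\mathcal{A}$ generated by the commuting matrices $A_1,A_2,A_3$ satisfies \[ \dim_k\mathcal{A}\le \dim_k M . \] -/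

import Mathlib

open scoped DirectSum

/-- The monomial `x^a = x_1^{a_1} ⋯ x_n^{a_n}` in `k[x_1, …, x_n]`. -/
noncomputable def mono (k : Type*) [Field k] {n : ℕ} (a : Fin n →₀ ℕ) :
    MvPolynomial (Fin n) k :=
  MvPolynomial.monomial a 1

/-- An ideal of `k[x_1, …, x_n]` is monomial if it is generated by a set of monomials. -/
def IsMonomialIdeal {k : Type*} [Field k] {n : ℕ} (I : Ideal (MvPolynomial (Fin n) k)) : Prop :=
  ∃ s : Set (Fin n →₀ ℕ), I = Ideal.span (mono k '' s)

/-- For ideals `I ⊆ K` of `R`, the module `K/I`, realized as the image of `K` in `R/I`. -/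
abbrev subquotient {R : Type*} [CommRing R] (K I : Ideal R) : Submodule R (R ⧸ I) :=
  Submodule.map (Submodule.mkQ I) K

/-- A gluing datum `(I, J, K, L, φ)` over `S = k[x_1, …, x_n]`: monomial ideals `I ⊆ K`, `J ⊆ L`
with `S/I` and `S/J` finite-dimensional over `k`, and an isomorphism of `S`-modules
`φ : K/I ≃ L/J` that sends (nonzero classes of) monomials to monomials. -/
structure GluingDatum (k : Type*) [Field k] (n : ℕ) where
  I : Ideal (MvPolynomial (Fin n) k)
  J : Ideal (MvPolynomial (Fin n) k)
  K : Ideal (MvPolynomial (Fin n) k)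
  L : Ideal (MvPolynomial (Fin n) k)
  monomial_I : IsMonomialIdeal I
  monomial_J : IsMonomialIdeal J
  monomial_K : IsMonomialIdeal K
  monomial_L : IsMonomialIdeal L
  I_le_K : I ≤ K
  J_le_L : J ≤ L
  finite_I : Module.Finite k (MvPolynomial (Fin n) k ⧸ I)
  finite_J : Module.Finite k (MvPolynomial (Fin n) k ⧸ J)
  φ : subquotient K I ≃ₗ[MvPolynomial (Fin n) k] subquotient L J
  φ_monomial : ∀ f : subquotient K I, f ≠ 0 →
    (∃ a : Fin n →₀ ℕ, (f : MvPolynomial (Fin n) k ⧸ I) = Submodule.mkQ I (mono k a)) →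
      ∃ b : Fin n →₀ ℕ, (φ f : MvPolynomial (Fin n) k ⧸ J) = Submodule.mkQ J (mono k b)

namespace GluingDatum

/-- The submodule `{(f, -φ(f)) ∣ f ∈ K/I}` of `S/I ⊕ S/J`. -/
noncomputable def relations {k : Type*} [Field k] {n : ℕ} (D : GluingDatum k n) :
    Submodule (MvPolynomial (Fin n) k)
      ((MvPolynomial (Fin n) k ⧸ D.I) × (MvPolynomial (Fin n) k ⧸ D.J)) :=
  LinearMap.range ((subquotient D.K D.I).subtype.prod
    (-((subquotient D.L D.J).subtype ∘ₗ D.φ.toLinearMap)))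

/-- The glued module `M = (S/I ⊕ S/J) / {(f, -φ(f)) ∣ f ∈ K/I}`. -/
abbrev M {k : Type*} [Field k] {n : ℕ} (D : GluingDatum k n) : Type _ :=
  ((MvPolynomial (Fin n) k ⧸ D.I) × (MvPolynomial (Fin n) k ⧸ D.J)) ⧸ D.relations

/-- The set of classes of `(x^a, 0)` and of `(0, x^a)` in `M`. -/
def monomials {k : Type*} [Field k] {n : ℕ} (D : GluingDatum k n) : Set D.M :=
  Set.range (fun a : Fin n →₀ ℕ => D.relations.mkQ (Submodule.mkQ D.I (mono k a), 0)) ∪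
  Set.range (fun a : Fin n →₀ ℕ => D.relations.mkQ (0, Submodule.mkQ D.J (mono k a)))

/-- The `k`-linear map `M → M` given by multiplication by `x_i`. -/
noncomputable def mulX {k : Type*} [Field k] {n : ℕ} (D : GluingDatum k n) (i : Fin n) :
    D.M →ₗ[k] D.M :=
  Algebra.lsmul k k D.M (MvPolynomial.X i : MvPolynomial (Fin n) k)

/-- `(A_1, …, A_n)` are associated to the datum: with `d = dim M`, they are the `d × d` matrices of
multiplication by `x_1, …, x_n` on `M` in the monomial basis of `M`. The monomial basis is unique
only up to its order; every order is allowed. -/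
def IsAssociated {k : Type*} [Field k] {n : ℕ} (D : GluingDatum k n)
    (A : Fin n → Matrix (Fin (Module.finrank k D.M)) (Fin (Module.finrank k D.M)) k) : Prop :=
  ∃ b : Module.Basis (Fin (Module.finrank k D.M)) k D.M,
    (∀ j, b j ∈ D.monomials) ∧ ∀ i, A i = LinearMap.toMatrix b b (D.mulX i)

theorem finite_M {k : Type*} [Field k] {n : ℕ} (D : GluingDatum k n) : Module.Finite k D.M := by
  have := D.finite_I
  have := D.finite_J
  have h : Module.Finite k
      ((MvPolynomial (Fin n) k ⧸ D.I) × (MvPolynomial (Fin n) k ⧸ D.J)) := inferInstance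
  let f : ((MvPolynomial (Fin n) k ⧸ D.I) × (MvPolynomial (Fin n) k ⧸ D.J)) →ₗ[k] D.M :=
    D.relations.mkQ.restrictScalars k
  have hf : Function.Surjective f := D.relations.mkQ_surjective
  exact Module.Finite.of_surjective f hf

theorem span_monomials {k : Type*} [Field k] {n : ℕ} (D : GluingDatum k n) :
    ⊤ ≤ Submodule.span k D.monomials := by
  have key : ∀ (g : MvPolynomial (Fin n) k →ₗ[k] D.M),
      (∀ a, g (mono k a) ∈ D.monomials) → ∀ p, g p ∈ Submodule.span k D.monomials := by
    intro g hg p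
    induction p using MvPolynomial.induction_on' with
    | monomial a c =>
      have h : MvPolynomial.monomial a c = c • mono k a := by
        simp [mono, MvPolynomial.smul_monomial]
      rw [h, map_smul]
      exact Submodule.smul_mem _ _ (Submodule.subset_span (hg a))
    | add p q hp hq => rw [map_add]; exact Submodule.add_mem _ hp hq
  intro m _
  obtain ⟨⟨u, v⟩, rfl⟩ := Submodule.mkQ_surjective _ m
  obtain ⟨p, rfl⟩ := Submodule.mkQ_surjective _ u
  obtain ⟨q, rfl⟩ := Submodule.mkQ_surjective _ v
  have h1 := key ((D.relations.mkQ ∘ₗ LinearMap.inl _ _ _ ∘ₗ Submodule.mkQ D.I).restrictScalars k)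
    (fun a => Or.inl ⟨a, rfl⟩) p
  have h2 := key ((D.relations.mkQ ∘ₗ LinearMap.inr _ _ _ ∘ₗ Submodule.mkQ D.J).restrictScalars k)
    (fun a => Or.inr ⟨a, rfl⟩) q
  have h3 : D.relations.mkQ (Submodule.mkQ D.I p, Submodule.mkQ D.J q) =
      D.relations.mkQ (Submodule.mkQ D.I p, 0) + D.relations.mkQ (0, Submodule.mkQ D.J q) := by
    rw [← map_add, Prod.mk_add_mk, add_zero, zero_add]
  rw [h3]
  exact Submodule.add_mem _ h1 h2

/-- Every gluing datum has associated matrices. -/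
theorem exists_isAssociated {k : Type*} [Field k] {n : ℕ} (D : GluingDatum k n) :
    ∃ A, D.IsAssociated A := by
  have := D.finite_M
  let b := Module.Basis.ofSpan D.span_monomials
  have := Module.Finite.finite_basis b
  let e := Finite.equivFinOfCardEq (Module.finrank_eq_nat_card_basis b).symm
  refine ⟨_, b.reindex e, fun j => ?_, fun i => rfl⟩
  rw [Module.Basis.reindex_apply]
  exact Module.Basis.ofSpan_subset D.span_monomials ⟨_, rfl⟩

end GluingDatum

/-- The combinatorial Gerstenhaber problem holds when gluing along the `S`-module `N`: for every
gluing datum with `K/I ≃ N`, the unital `k`-algebra generated by the associated matrices has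
dimension at most `dim M`. -/
def CombinatorialGerstenhaberHolds (k : Type*) [Field k] (n : ℕ) (N : Type*) [AddCommGroup N]
    [Module (MvPolynomial (Fin n) k) N] : Prop :=
  ∀ D : GluingDatum k n,
    Nonempty (subquotient D.K D.I ≃ₗ[MvPolynomial (Fin n) k] N) →
    ∀ A, D.IsAssociated A →
      Module.finrank k (Algebra.adjoin k (Set.range A)) ≤ Module.finrank k D.M

/-! Of the module N only its annihilation by x₁ and x₂ matters. The generated algebra is a quotient
of S/(I ∩ J), whose dimension is dim S/I + dim S/J - dim S/(I + J), while dim M = dim S/I + dim S/J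
- dim K/I. So it suffices that dim K/I ≤ dim S/(I + J). If A, A' are the exponents of the monomials
outside I, J, and B those of the monomials in K but not in I, this reads |B| ≤ |A ∩ A'|
(`card_le_card_inter_of_translation`).

Cut A and A' into slices l h, m h of constant x₃-degree h: plane lower sets that shrink as h grows.
B splits into columns parallel to the third axis; φ carries them to columns of equal size. By the
annihilation, the columns of B present at height h form an antichain in l h, and those of φ(B) one
in m h. If C h and D h are the sizes of the largest staircases in l h and m h, these antichains have
at most C h and D h elements (`mem_of_lt_card_antichain`), whereas |l h ∩ m h| is at least the
smallest of |l h|, |m h| and C h + D h - 1 (`min_card_le_card_inter`).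

Since φ may move columns to other heights, the slices cannot be compared one by one. Instead each
column is counted either by its heights in B or by its heights in φ(B). Once both families of top
heights are sorted (`exists_rearrangement`), `exists_distribution` makes these choices so that the
count at every h respects all three bounds. -/

/-! ### Antichains and intersections of plane lower sets -/

/-- A lower set of `ℕ × ℕ` that contains an antichain of size greater than `x + y` contains
`(x, y)`. -/
theorem mem_of_lt_card_antichain {l : Set (ℕ × ℕ)} (hl : IsLowerSet l) {A : Finset (ℕ × ℕ)}
    (hA : ∀ a ∈ A, a ∈ l) (hanti : ∀ a ∈ A, ∀ b ∈ A, a ≤ b → a = b) {x y : ℕ}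
    (h : x + y < A.card) : (x, y) ∈ l := by
  by_contra hxy
  -- A point of `A` outside both filters would dominate `(x, y)`. Each coordinate is injective on an
  -- antichain, so the two filters have at most `x` and `y` points.
  have hcov : A ⊆ A.filter (fun a => a.1 < x) ∪ A.filter (fun a => a.2 < y) := by
    intro a ha
    by_contra hn
    simp only [Finset.mem_union, Finset.mem_filter, ha, true_and, not_or, not_lt] at hn
    exact hxy (hl (show (x, y) ≤ a from hn) (hA a ha))
  have h1 : (A.filter (fun a => a.1 < x)).card ≤ x := by
    rw [← Finset.card_range x]
    refine Finset.card_le_card_of_injOn Prod.fst (fun a ha => ?_) ?_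
    · simpa using (Finset.mem_filter.1 ha).2
    · intro a ha b hb hab
      have ha' := (Finset.mem_filter.1 ha).1
      have hb' := (Finset.mem_filter.1 hb).1
      rcases le_total a.2 b.2 with h | h
      · exact hanti a ha' b hb' ⟨hab.le, h⟩
      · exact (hanti b hb' a ha' ⟨hab.ge, h⟩).symm
  have h2 : (A.filter (fun a => a.2 < y)).card ≤ y := by
    rw [← Finset.card_range y]
    refine Finset.card_le_card_of_injOn Prod.snd (fun a ha => ?_) ?_
    · simpa using (Finset.mem_filter.1 ha).2
    · intro a ha b hb hab
      have ha' := (Finset.mem_filter.1 ha).1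
      have hb' := (Finset.mem_filter.1 hb).1
      rcases le_total a.1 b.1 with h | h
      · exact hanti a ha' b hb' ⟨h, hab.le⟩
      · exact (hanti b hb' a ha' ⟨h, hab.ge⟩).symm
  have := (Finset.card_le_card hcov).trans (Finset.card_union_le _ _)
  omega

/-- If the lower sets `l` and `m` of `ℕ × ℕ` are incomparable and contain the staircases of sizes
`c` and `d`, then `l ∩ m` has at least `c + d - 1` elements. -/
theorem le_card_inter_of_not_subset {l m : Finset (ℕ × ℕ)} (hl : IsLowerSet (l : Set (ℕ × ℕ)))
    (hm : IsLowerSet (m : Set (ℕ × ℕ))) {c d : ℕ} (hc : ∀ x y, x + y < c → (x, y) ∈ l)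
    (hd : ∀ x y, x + y < d → (x, y) ∈ m) (hlm : ¬ l ⊆ m) (hml : ¬ m ⊆ l) :
    c + d - 1 ≤ (l ∩ m).card := by
  obtain ⟨⟨x₁, x₂⟩, hxl, hxm⟩ := Finset.not_subset.1 hlm
  obtain ⟨⟨y₁, y₂⟩, hym, hyl⟩ := Finset.not_subset.1 hml
  have hl' : ∀ a b a' b' : ℕ, a ≤ a' → b ≤ b' → (a', b') ∈ l → (a, b) ∈ l :=
    fun a b a' b' h1 h2 h => hl (show (a, b) ≤ (a', b') from ⟨h1, h2⟩) h
  have hm' : ∀ a b a' b' : ℕ, a ≤ a' → b ≤ b' → (a', b') ∈ m → (a, b) ∈ m :=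
    fun a b a' b' h1 h2 h => hm (show (a, b) ≤ (a', b') from ⟨h1, h2⟩) h
  have hxd : d ≤ x₁ + x₂ := by
    by_contra h
    exact hxm (hd _ _ (by omega))
  have hyc : c ≤ y₁ + y₂ := by
    by_contra h
    exact hyl (hc _ _ (by omega))
  -- up to the symmetry of the two coordinates, `x₁ < y₁` and `y₂ < x₂`
  wlog hxy : x₁ < y₁ generalizing l m c d x₁ x₂ y₁ y₂
  · have hlt : y₁ < x₁ := by
      rcases lt_trichotomy x₁ y₁ with h | h | h
      · exact absurd h hxy
      · subst h
        rcases le_total x₂ y₂ with h | h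
        · exact absurd (hm' _ _ _ _ le_rfl h hym) hxm
        · exact absurd (hl' _ _ _ _ le_rfl h hxl) hyl
      · exact h
    have := this hm hl hd hc hml hlm y₁ y₂ hym hyl x₁ x₂ hxl hxm hm' hl' hyc hxd hlt
    rwa [Finset.inter_comm, add_comm]
  have hxy2 : y₂ < x₂ := by
    by_contra h
    exact hxm (hm' _ _ _ _ hxy.le (by omega) hym)
  -- Two lattice paths from the origin with one point on each antidiagonal: `f` runs along the left
  -- and top sides of the rectangle below `x`, `g` along the bottom and right sides of the rectangle
  -- below `y`. The rectangles lie in `l` and `m`; the staircases put the first `d` points of `f` in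
  -- `m` and the first `c` points of `g` in `l`.
  let f : ℕ → ℕ × ℕ := fun k => if k ≤ x₂ then (0, k) else (k - x₂, x₂)
  let g : ℕ → ℕ × ℕ := fun k => if k ≤ y₁ then (k, 0) else (y₁, k - y₁)
  have hf : ∀ k, (f k).1 + (f k).2 = k := by
    intro k
    simp only [f]
    split_ifs
    · simp
    · simp; omega
  have hg : ∀ k, (g k).1 + (g k).2 = k := by
    intro k
    simp only [g]
    split_ifs
    · simp
    · simp; omega
  have hfi : Function.Injective f := fun a b h => by rw [← hf a, ← hf b, h]
  have hgi : Function.Injective g := fun a b h => by rw [← hg a, ← hg b, h]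
  -- Both paths start at the origin, so `g` is taken from 1 on; this is the `- 1` in the bound.
  have hdisj : Disjoint ((Finset.range d).image f) ((Finset.Ico 1 c).image g) := by
    rw [Finset.disjoint_left]
    intro z hz hz'
    obtain ⟨k, hk, rfl⟩ := Finset.mem_image.1 hz
    obtain ⟨k', hk', hkk⟩ := Finset.mem_image.1 hz'
    rw [Finset.mem_range] at hk
    rw [Finset.mem_Ico] at hk'
    simp only [f, g] at hkk
    split_ifs at hkk <;> simp only [Prod.mk.injEq] at hkk <;> omega
  have hsub : (Finset.range d).image f ∪ (Finset.Ico 1 c).image g ⊆ l ∩ m := by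
    intro z hz
    rcases Finset.mem_union.1 hz with hz | hz
    · obtain ⟨k, hk, rfl⟩ := Finset.mem_image.1 hz
      rw [Finset.mem_range] at hk
      refine Finset.mem_inter.2 ⟨?_, hd (f k).1 (f k).2 (by rw [hf]; exact hk)⟩
      simp only [f]
      split_ifs with h
      · exact hl' _ _ _ _ (Nat.zero_le _) h hxl
      · exact hl' _ _ _ _ (by omega) le_rfl hxl
    · obtain ⟨k, hk, rfl⟩ := Finset.mem_image.1 hz
      rw [Finset.mem_Ico] at hk
      refine Finset.mem_inter.2 ⟨hc (g k).1 (g k).2 (by rw [hg]; exact hk.2), ?_⟩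
      simp only [g]
      split_ifs with h
      · exact hm' _ _ _ _ h (Nat.zero_le _) hym
      · exact hm' _ _ _ _ le_rfl (by omega) hym
  have := Finset.card_le_card hsub
  rw [Finset.card_union_of_disjoint hdisj, Finset.card_image_of_injective _ hfi,
    Finset.card_image_of_injective _ hgi, Finset.card_range, Nat.card_Ico] at this
  omega

/-- If one set contains the other, the intersection is the smaller one; otherwise the two lattice
paths give the staircase bound. -/
theorem min_card_le_card_inter {l m : Finset (ℕ × ℕ)} (hl : IsLowerSet (l : Set (ℕ × ℕ)))
    (hm : IsLowerSet (m : Set (ℕ × ℕ))) {c d : ℕ} (hc : ∀ x y, x + y < c → (x, y) ∈ l)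
    (hd : ∀ x y, x + y < d → (x, y) ∈ m) :
    min (min l.card m.card) (c + d - 1) ≤ (l ∩ m).card := by
  by_cases hlm : l ⊆ m
  · rw [Finset.inter_eq_left.2 hlm]; omega
  by_cases hml : m ⊆ l
  · rw [Finset.inter_eq_right.2 hml]; omega
  have := le_card_inter_of_not_subset hl hm hc hd hlm hml
  omega

/-! ### Distributing and rearranging columns -/

/-- The rows of two monotone families of row lengths `r`, `s` can be distributed over two sets
`G`, `Q` so that the columns of `r` over `G`, capped by `C`, and the columns of `s` over `Q`, capped
by `D`, have together at most `C + D - 1` elements, and at most as many as there are common rows. -/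
theorem exists_distribution {ι : Type*} [LinearOrder ι] {r s : ι → ℕ} (hr : Monotone r)
    (hs : Monotone s) {C D : ℕ → ℕ} (hC : Antitone C) (hD : Antitone D)
    (hr0 : ∀ v, 0 < r v) (hs0 : ∀ v, 0 < s v) (hC1 : ∀ v h, h < r v → 1 ≤ C h) (V : Finset ι) :
    ∃ G Q : Finset ι, Disjoint G Q ∧ G ∪ Q = V ∧
      (∀ h, min (C h) (G.filter (fun v => h < r v)).card +
        min (D h) (Q.filter (fun v => h < s v)).card ≤
          min (V.filter (fun v => h < r v ∧ h < s v)).card (C h + D h - 1)) ∧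
      ∀ h, 1 ≤ C h → (∀ v ∈ V, h < r v ∧ h < s v) → G.card < C h ∨ Q.card < D h := by
  -- Rows are added by decreasing index, so the new row is a shortest one in both families: where it
  -- is present, all earlier rows are too. The last conjunct, that `G` and `Q` are not both full, is
  -- the invariant that leaves room for the next row.
  induction V using Finset.induction_on_min with
  | empty => exact ⟨∅, ∅, by simp, by simp, by simp, fun h hh _ => Or.inl hh⟩
  | insert a V ha ih =>
    obtain ⟨G, Q, hGQ, hV, hx, hb⟩ := ih
    have haV : a ∉ V := fun h => lt_irrefl _ (ha a h)
    have haG : a ∉ G := fun h => haV (hV ▸ Finset.mem_union_left _ h)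
    have haQ : a ∉ Q := fun h => haV (hV ▸ Finset.mem_union_right _ h)
    have hGV : ∀ v ∈ G, v ∈ V := fun v h => hV ▸ Finset.mem_union_left _ h
    have hQV : ∀ v ∈ Q, v ∈ V := fun v h => hV ▸ Finset.mem_union_right _ h
    have hcard : V.card = G.card + Q.card := by rw [← hV, Finset.card_union_of_disjoint hGQ]
    have hra : ∀ v ∈ V, r a ≤ r v := fun v h => hr (ha v h).le
    have hsa : ∀ v ∈ V, s a ≤ s v := fun v h => hs (ha v h).le
    have hGr : ∀ h, h < r a → G.filter (fun v => h < r v) = G := fun h hh =>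
      Finset.filter_true_of_mem fun v hv => hh.trans_le (hra v (hGV v hv))
    have hQs : ∀ h, h < s a → Q.filter (fun v => h < s v) = Q := fun h hh =>
      Finset.filter_true_of_mem fun v hv => hh.trans_le (hsa v (hQV v hv))
    have hVrs : ∀ h, h < r a → h < s a → V.filter (fun v => h < r v ∧ h < s v) = V :=
      fun h h1 h2 => Finset.filter_true_of_mem fun v hv =>
        ⟨h1.trans_le (hra v hv), h2.trans_le (hsa v hv)⟩
    have hr0a := hr0 a
    have hs0a := hs0 a
    have hCa : ∀ h, h < min (r a) (s a) → C (min (r a) (s a) - 1) ≤ C h := fun h hh =>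
      hC (by omega)
    have hDa : ∀ h, h < min (r a) (s a) → D (min (r a) (s a) - 1) ≤ D h := fun h hh =>
      hD (by omega)
    have hCa' : ∀ h, min (r a) (s a) ≤ h → C h ≤ C (min (r a) (s a) - 1) := fun h hh =>
      hC (by omega)
    have hDa' : ∀ h, min (r a) (s a) ≤ h → D h ≤ D (min (r a) (s a) - 1) := fun h hh =>
      hD (by omega)
    -- The invariant is used at the last height where the new row is present in both families.
    have hbτ := hb (min (r a) (s a) - 1) (hC1 a _ (by omega)) (fun v hv => by
      have := hra v hv
      have := hsa v hv
      omega)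
    -- The new row goes to the side where it is shorter, unless the other side is already full at
    -- this last common height. In that case it goes to the full side: the cap absorbs it at the
    -- heights beyond, where the number of common rows does not grow. Either way the side not chosen
    -- is below its cap at all common heights, which gives the `- 1`.
    by_cases hput : (r a ≤ s a ∧ Q.card < D (min (r a) (s a) - 1)) ∨
        (s a < r a ∧ C (min (r a) (s a) - 1) ≤ G.card)
    · refine ⟨insert a G, Q, Finset.disjoint_insert_left.2 ⟨haQ, hGQ⟩, by
        rw [Finset.insert_union, hV], fun h => ?_, fun h hh hall => ?_⟩
      · have hxh := hx h
        rw [Finset.filter_insert, Finset.filter_insert]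
        by_cases h1 : h < r a
        · by_cases h2 : h < s a
          · have e1 := hCa h (by omega)
            have e2 := hDa h (by omega)
            rw [if_pos h1, if_pos ⟨h1, h2⟩, hGr h h1, hQs h h2, hVrs h h1 h2,
              Finset.card_insert_of_notMem haG, Finset.card_insert_of_notMem haV]
            rw [hGr h h1, hQs h h2, hVrs h h1 h2] at hxh
            omega
          · have e1 := hCa' h (by omega)
            rw [if_pos h1, if_neg (fun h => h2 h.2), hGr h h1, Finset.card_insert_of_notMem haG]
            rw [hGr h h1] at hxh
            omega
        · rw [if_neg h1, if_neg (fun h => h1 h.1)]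
          exact hxh
      · have hha := hall a (Finset.mem_insert_self _ _)
        have e1 := hCa h (by omega)
        have e2 := hDa h (by omega)
        rw [Finset.card_insert_of_notMem haG]
        omega
    · refine ⟨G, insert a Q, Finset.disjoint_insert_right.2 ⟨haG, hGQ⟩, by
        rw [Finset.union_insert, hV], fun h => ?_, fun h hh hall => ?_⟩
      · have hxh := hx h
        rw [Finset.filter_insert, Finset.filter_insert]
        by_cases h2 : h < s a
        · by_cases h1 : h < r a
          · have e1 := hCa h (by omega)
            have e2 := hDa h (by omega)
            rw [if_pos h2, if_pos ⟨h1, h2⟩, hGr h h1, hQs h h2, hVrs h h1 h2,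
              Finset.card_insert_of_notMem haQ, Finset.card_insert_of_notMem haV]
            rw [hGr h h1, hQs h h2, hVrs h h1 h2] at hxh
            omega
          · have e1 := hDa' h (by omega)
            rw [if_pos h2, if_neg (fun h => h1 h.1), hQs h h2, Finset.card_insert_of_notMem haQ]
            rw [hQs h h2] at hxh
            omega
        · rw [if_neg h2, if_neg (fun h => h2 h.2)]
          exact hxh
      · have hha := hall a (Finset.mem_insert_self _ _)
        have e1 := hCa h (by omega)
        have e2 := hDa h (by omega)
        rw [Finset.card_insert_of_notMem haQ]
        omega

/-- Sets `X v ⊆ {0, …, r v - 1}` of monotonically growing cardinality can be rearranged, without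
enlarging the columns `{v ∣ h ∈ X v}`, so that they fit the sorted lengths. -/
theorem exists_rearrangement {N : ℕ} {n : Fin N → ℕ} (hn : Monotone n) (r : Fin N → ℕ) {C : ℕ → ℕ}
    (hX : ∃ X : Fin N → Finset ℕ, (∀ v, X v ⊆ Finset.range (r v)) ∧ (∀ v, (X v).card = n v) ∧
      ∀ h, (Finset.univ.filter (fun v => h ∈ X v)).card ≤ C h) :
    ∃ X : Fin N → Finset ℕ, (∀ v, X v ⊆ Finset.range ((r ∘ Tuple.sort r) v)) ∧
      (∀ v, (X v).card = n v) ∧ ∀ h, (Finset.univ.filter (fun v => h ∈ X v)).card ≤ C h := by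
  refine Tuple.bubble_sort_induction (P := fun ρ : Fin N → ℕ => ∃ X : Fin N → Finset ℕ,
    (∀ v, X v ⊆ Finset.range (ρ v)) ∧ (∀ v, (X v).card = n v) ∧
      ∀ h, (Finset.univ.filter (fun v => h ∈ X v)).card ≤ C h) hX ?_
  rintro ρ i j hij hlt ⟨X, hsub, hcard, hcol⟩
  -- To exchange the lengths at `i < j`, where `ρ j < ρ i`, exchange the two sets and restore their
  -- sizes by moving `n j - n i` elements of `X j` outside `X i` back to position `j`, where they
  -- fit because the new length there is larger.
  have hle : n j - n i ≤ (X j \ X i).card := by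
    have := Finset.le_card_sdiff (X i) (X j)
    rwa [hcard, hcard] at this
  obtain ⟨M, hM, hMc⟩ := Finset.exists_subset_card_eq hle
  have hnij := hn hij.le
  have hMj : M ⊆ X j := hM.trans Finset.sdiff_subset
  have hMi : Disjoint (X i) M := Finset.disjoint_of_subset_right hM Finset.disjoint_sdiff
  let X' : Fin N → Finset ℕ := Function.update (Function.update X i (X j \ M)) j (X i ∪ M)
  have hj : X' j = X i ∪ M := Function.update_self _ _ _
  have hi : X' i = X j \ M := by
    simp only [X', Function.update_of_ne hij.ne, Function.update_self]
  have ho : ∀ v, v ≠ i → v ≠ j → X' v = X v := fun v h1 h2 => by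
    simp only [X', Function.update_of_ne h1, Function.update_of_ne h2]
  refine ⟨X', fun v => ?_, fun v => ?_, fun h => ?_⟩
  · rcases eq_or_ne v j with rfl | hvj
    · rw [hj, Function.comp_apply, Equiv.swap_apply_right]
      exact Finset.union_subset (hsub i)
        ((hMj.trans (hsub v)).trans (Finset.range_subset_range.2 hlt.le))
    rcases eq_or_ne v i with rfl | hvi
    · rw [hi, Function.comp_apply, Equiv.swap_apply_left]
      exact Finset.sdiff_subset.trans (hsub j)
    · rw [ho v hvi hvj, Function.comp_apply, Equiv.swap_apply_of_ne_of_ne hvi hvj]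
      exact hsub v
  · rcases eq_or_ne v j with rfl | hvj
    · rw [hj, Finset.card_union_of_disjoint hMi, hcard, hMc]
      omega
    rcases eq_or_ne v i with rfl | hvi
    · rw [hi, Finset.card_sdiff_of_subset hMj, hcard, hMc]
      omega
    · rw [ho v hvi hvj, hcard]
  -- Every height keeps its multiplicity: `X i` and `X j` are only redistributed.
  · refine le_of_eq_of_le ?_ (hcol h)
    have key : ∀ Z : Fin N → Finset ℕ, (Finset.univ.filter (fun v => h ∈ Z v)).card =
        (if h ∈ Z i then 1 else 0) + ((if h ∈ Z j then 1 else 0) +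
          ∑ v ∈ (Finset.univ.erase i).erase j, if h ∈ Z v then 1 else 0) := fun Z => by
      rw [Finset.card_filter, Finset.add_sum_erase _ (fun v => if h ∈ Z v then 1 else 0)
        (Finset.mem_erase.2 ⟨hij.ne', Finset.mem_univ _⟩),
        Finset.add_sum_erase _ (fun v => if h ∈ Z v then 1 else 0) (Finset.mem_univ _)]
    rw [key, key, hi, hj]
    have hrest : ∑ v ∈ (Finset.univ.erase i).erase j, (if h ∈ X' v then 1 else 0) =
        ∑ v ∈ (Finset.univ.erase i).erase j, if h ∈ X v then 1 else 0 := by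
      refine Finset.sum_congr rfl fun v hv => ?_
      rw [Finset.mem_erase, Finset.mem_erase] at hv
      rw [ho v hv.2.1 hv.1]
    rw [hrest, ← add_assoc, ← add_assoc]
    congr 1
    have h1 : h ∈ M → h ∈ X j := fun hh => hMj hh
    have h2 : h ∈ M → h ∉ X i := fun hh => (Finset.mem_sdiff.1 (hM hh)).2
    simp only [Finset.mem_sdiff, Finset.mem_union]
    by_cases hm : h ∈ M <;> by_cases hxi : h ∈ X i <;> by_cases hxj : h ∈ X j <;>
      simp_all

/-- Double counting of the pairs `(v, h)` with `h ∈ X v`; at height `h` both the column bound and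
the number of rows reaching beyond `h` apply. -/
theorem sum_card_le_sum_min {ι : Type*} (G : Finset ι) {X : ι → Finset ℕ} {r : ι → ℕ} {H : ℕ}
    {C : ℕ → ℕ} (hX : ∀ v ∈ G, X v ⊆ Finset.range (r v)) (hr : ∀ v, r v ≤ H)
    (hC : ∀ h, (G.filter (fun v => h ∈ X v)).card ≤ C h) :
    ∑ v ∈ G, (X v).card ≤
      ∑ h ∈ Finset.range H, min (C h) (G.filter (fun v => h < r v)).card := by
  have h1 : ∀ v ∈ G, (X v).card = ∑ h ∈ Finset.range H, if h ∈ X v then 1 else 0 := by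
    intro v hv
    rw [← Finset.card_filter]
    congr 1
    ext h
    simp only [Finset.mem_filter, Finset.mem_range]
    exact ⟨fun hh => ⟨(Finset.mem_range.1 (hX v hv hh)).trans_le (hr v), hh⟩, fun hh => hh.2⟩
  rw [Finset.sum_congr rfl h1, Finset.sum_comm]
  refine Finset.sum_le_sum fun h _ => ?_
  rw [← Finset.card_filter]
  refine le_min (hC h) (Finset.card_le_card fun v hv => ?_)
  rw [Finset.mem_filter] at hv ⊢
  exact ⟨hv.1, Finset.mem_range.1 (hX v hv.1 hv.2)⟩

theorem card_filter_lt_comp_sort {N : ℕ} (r : Fin N → ℕ) (h : ℕ) :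
    (Finset.univ.filter (fun v => h < (r ∘ Tuple.sort r) v)).card =
      (Finset.univ.filter (fun v => h < r v)).card := by
  refine Finset.card_bij (fun v _ => Tuple.sort r v) (by simp) (by simp) fun v hv => ?_
  exact ⟨(Tuple.sort r).symm v, by simpa using hv, by simp⟩

/-- Let `X`, `Y` be families of finite sets of naturals with `|X v| = |Y v|`, whose columns
`{v ∣ h ∈ X v}` and `{v ∣ h ∈ Y v}` are bounded by `C h` and `D h`. Then the total size is bounded
in terms of `C`, `D` and the numbers of sets that reach beyond each `h`. -/
theorem sum_card_le_of_monotone {N : ℕ} {n : Fin N → ℕ} (hn : Monotone n) (r s : Fin N → ℕ)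
    {C D : ℕ → ℕ} (hC : Antitone C) (hD : Antitone D) (hr0 : ∀ v, 0 < r v) (hs0 : ∀ v, 0 < s v)
    (hC1 : ∀ v h, h < r v → 1 ≤ C h) {X Y : Fin N → Finset ℕ}
    (hX : ∀ v, X v ⊆ Finset.range (r v)) (hY : ∀ v, Y v ⊆ Finset.range (s v))
    (hXn : ∀ v, (X v).card = n v) (hYn : ∀ v, (Y v).card = n v)
    (hXC : ∀ h, (Finset.univ.filter (fun v => h ∈ X v)).card ≤ C h)
    (hYD : ∀ h, (Finset.univ.filter (fun v => h ∈ Y v)).card ≤ D h) {H : ℕ}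
    (hrH : ∀ v, r v ≤ H) (hsH : ∀ v, s v ≤ H) :
    ∑ v, n v ≤ ∑ h ∈ Finset.range H, min (min (Finset.univ.filter (fun v => h < r v)).card
      (Finset.univ.filter (fun v => h < s v)).card) (C h + D h - 1) := by
  -- The families are sorted by different permutations. This is harmless because both rearrangements
  -- keep the same size `n v` at each index, so a term `n v` may be read off from either side.
  obtain ⟨X', hX', hXn', hXC'⟩ := exists_rearrangement hn r ⟨X, hX, hXn, hXC⟩
  obtain ⟨Y', hY', hYn', hYD'⟩ := exists_rearrangement hn s ⟨Y, hY, hYn, hYD⟩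
  obtain ⟨G, Q, hGQ, hV, hx, -⟩ := exists_distribution (Tuple.monotone_sort r)
    (Tuple.monotone_sort s) hC hD (fun v => hr0 _) (fun v => hs0 _) (fun v => hC1 _) Finset.univ
  have hG := sum_card_le_sum_min G (fun v _ => hX' v) (fun v => hrH _) fun h =>
    (Finset.card_le_card (Finset.filter_subset_filter _ (Finset.subset_univ G))).trans (hXC' h)
  have hQ := sum_card_le_sum_min Q (fun v _ => hY' v) (fun v => hsH _) fun h =>
    (Finset.card_le_card (Finset.filter_subset_filter _ (Finset.subset_univ Q))).trans (hYD' h)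
  rw [← hV, Finset.sum_union hGQ, ← Finset.sum_congr rfl fun v _ => hXn' v,
    ← Finset.sum_congr rfl fun v _ => hYn' v]
  refine (add_le_add hG hQ).trans ?_
  rw [← Finset.sum_add_distrib]
  refine Finset.sum_le_sum fun h _ => (hx h).trans ?_
  rw [hV, ← card_filter_lt_comp_sort r, ← card_filter_lt_comp_sort s]
  refine min_le_min_right _ (le_min ?_ ?_) <;> refine Finset.card_le_card fun v hv => ?_ <;>
    rw [Finset.mem_filter] at hv ⊢
  exacts [⟨hv.1, hv.2.1⟩, ⟨hv.1, hv.2.2⟩]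

/-! ### Staircases and stacks of slices -/

/-- The size of the largest staircase `{(x, y) ∣ x + y < c}` contained in `l`. -/
noncomputable def staircaseSize (l : Finset (ℕ × ℕ)) : ℕ :=
  sInf {c | ∃ a : ℕ × ℕ, a ∉ l ∧ a.1 + a.2 = c}

theorem mem_of_lt_staircaseSize {l : Finset (ℕ × ℕ)} {x y : ℕ} (h : x + y < staircaseSize l) :
    (x, y) ∈ l := by
  by_contra hxy
  exact Nat.notMem_of_lt_sInf h ⟨(x, y), hxy, rfl⟩

theorem le_staircaseSize {l : Finset (ℕ × ℕ)} {c : ℕ} (hc : ∀ x y, x + y < c → (x, y) ∈ l) :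
    c ≤ staircaseSize l := by
  obtain ⟨a, ha⟩ := Infinite.exists_notMem_finset l
  obtain ⟨b, hb, hbs⟩ := Nat.sInf_mem (s := {c | ∃ a : ℕ × ℕ, a ∉ l ∧ a.1 + a.2 = c})
    ⟨_, a, ha, rfl⟩
  by_contra! hlt
  exact hb (hc _ _ (hbs.trans_lt hlt))

theorem staircaseSize_mono : Monotone staircaseSize := fun _ _ h =>
  le_staircaseSize fun _ _ hxy => h (mem_of_lt_staircaseSize hxy)

/-- Let `l`, `m` be decreasing sequences of finite lower sets of `ℕ × ℕ`. Suppose that columns over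
distinct points `p t` carry disjoint antichains of the `l h`, and likewise for `q t` and `m h`. If
corresponding columns have equal sizes, then their total size is at most `∑ |l h ∩ m h|`. -/
theorem sum_card_le_sum_card_inter {T : Type*} [Fintype T] {l m : ℕ → Finset (ℕ × ℕ)}
    (hl : ∀ h, IsLowerSet (l h : Set (ℕ × ℕ))) (hm : ∀ h, IsLowerSet (m h : Set (ℕ × ℕ)))
    (hla : Antitone l) (hma : Antitone m) {H : ℕ} (hlH : l H = ∅) (hmH : m H = ∅)
    {p q : T → ℕ × ℕ} (hp : Function.Injective p) (hq : Function.Injective q)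
    {X Y : T → Finset ℕ} (hXY : ∀ t, (X t).card = (Y t).card) (hne : ∀ t, (X t).Nonempty)
    (hpX : ∀ t, ∀ h ∈ X t, p t ∈ l h) (hqY : ∀ t, ∀ h ∈ Y t, q t ∈ m h)
    (hpa : ∀ t t' h, h ∈ X t → h ∈ X t' → p t ≤ p t' → t = t')
    (hqa : ∀ t t' h, h ∈ Y t → h ∈ Y t' → q t ≤ q t' → t = t') :
    ∑ t, (X t).card ≤ ∑ h ∈ Finset.range H, (l h ∩ m h).card := by
  classical
  let e₀ := Fintype.equivFin T
  let n₀ : Fin (Fintype.card T) → ℕ := fun v => (X (e₀.symm v)).card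
  -- Columns are enumerated by increasing size, as rearranging requires.
  let e : Fin (Fintype.card T) ≃ T := (Tuple.sort n₀).trans e₀.symm
  have hn : Monotone fun v => (X (e v)).card := Tuple.monotone_sort n₀
  have hneY : ∀ t, (Y t).Nonempty := fun t => by
    rw [← Finset.card_pos, ← hXY, Finset.card_pos]
    exact hne t
  -- The columns present at height `h` form an antichain, which forces a staircase of the same size
  -- into `l h`.
  have hcol : ∀ {l : ℕ → Finset (ℕ × ℕ)} (_ : ∀ h, IsLowerSet (l h : Set (ℕ × ℕ)))
      {p : T → ℕ × ℕ} (_ : Function.Injective p) {X : T → Finset ℕ}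
      (_ : ∀ t, ∀ h ∈ X t, p t ∈ l h) (_ : ∀ t t' h, h ∈ X t → h ∈ X t' → p t ≤ p t' → t = t')
      (h : ℕ), (Finset.univ.filter (fun v => h ∈ X (e v))).card ≤ staircaseSize (l h) := by
    intro l hl p hp X hpX hpa h
    refine le_staircaseSize fun x y hxy => ?_
    refine mem_of_lt_card_antichain (hl h)
      (A := (Finset.univ.filter (fun v => h ∈ X (e v))).image fun v => p (e v)) ?_ ?_ ?_
    · intro a ha
      obtain ⟨v, hv, rfl⟩ := Finset.mem_image.1 ha
      exact hpX _ _ (Finset.mem_filter.1 hv).2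
    · intro a ha b hb hab
      obtain ⟨v, hv, rfl⟩ := Finset.mem_image.1 ha
      obtain ⟨w, hw, rfl⟩ := Finset.mem_image.1 hb
      rw [hpa _ _ h (Finset.mem_filter.1 hv).2 (Finset.mem_filter.1 hw).2 hab]
    · rwa [Finset.card_image_of_injective _ (show Function.Injective fun v => p (e v) from
        hp.comp e.injective)]
  have hlast : ∀ {l : ℕ → Finset (ℕ × ℕ)} (_ : Antitone l) {p : T → ℕ × ℕ} {X : T → Finset ℕ}
      (_ : ∀ t, (X t).Nonempty) (_ : ∀ t, ∀ h ∈ X t, p t ∈ l h) (t : T) (h : ℕ),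
      h < (X t).sup id + 1 → p t ∈ l h := by
    intro l hla p X hne hpX t h hh
    obtain ⟨h', hh', hs⟩ := Finset.exists_mem_eq_sup (X t) (hne t) id
    rw [hs] at hh
    exact hla (Nat.lt_succ_iff.1 hh) (hpX t h' hh')
  -- As `l` is decreasing, a column lies over `l h` for every `h` up to its top, whether or not `h`
  -- belongs to it.
  have hcount : ∀ {l : ℕ → Finset (ℕ × ℕ)} (_ : Antitone l) {p : T → ℕ × ℕ}
      (_ : Function.Injective p) {X : T → Finset ℕ} (_ : ∀ t, (X t).Nonempty)
      (_ : ∀ t, ∀ h ∈ X t, p t ∈ l h) (h : ℕ),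
      (Finset.univ.filter (fun v => h < (X (e v)).sup id + 1)).card ≤ (l h).card := by
    intro l hla p hp X hne hpX h
    refine Finset.card_le_card_of_injOn (fun v => p (e v)) (fun v hv => ?_)
      (hp.comp e.injective).injOn
    exact hlast hla hne hpX _ _ (Finset.mem_filter.1 hv).2
  have hbound : ∀ {l : ℕ → Finset (ℕ × ℕ)} (_ : Antitone l) (_ : l H = ∅) {p : T → ℕ × ℕ}
      {X : T → Finset ℕ} (_ : ∀ t, (X t).Nonempty) (_ : ∀ t, ∀ h ∈ X t, p t ∈ l h) (t : T),
      (X t).sup id + 1 ≤ H := by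
    intro l hla hlH p X hne hpX t
    by_contra! hlt
    have := hlast hla hne hpX t H hlt
    rw [hlH] at this
    exact Finset.notMem_empty _ this
  have hsub : ∀ (X : T → Finset ℕ) (t : T), X t ⊆ Finset.range ((X t).sup id + 1) := fun X t h hh =>
    Finset.mem_range.2 (Nat.lt_succ_of_le (Finset.le_sup (f := id) hh))
  have key := sum_card_le_of_monotone hn (fun v => (X (e v)).sup id + 1)
    (fun v => (Y (e v)).sup id + 1) (C := fun h => staircaseSize (l h))
    (D := fun h => staircaseSize (m h)) (staircaseSize_mono.comp_antitone hla)
    (staircaseSize_mono.comp_antitone hma) (fun _ => Nat.succ_pos _) (fun _ => Nat.succ_pos _)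
    -- A nonempty lower set contains the origin, so its staircase has size at least 1.
    (fun v h hh => le_staircaseSize fun x y hxy => by
      have h0 : ((0, 0) : ℕ × ℕ) ≤ p (e v) := ⟨Nat.zero_le _, Nat.zero_le _⟩
      have hx : x = 0 := by omega
      have hy : y = 0 := by omega
      rw [hx, hy]
      exact hl h h0 (hlast hla hne hpX _ _ hh))
    (fun v => hsub X (e v)) (fun v => hsub Y (e v)) (fun _ => rfl) (fun v => (hXY _).symm)
    (hcol hl hp hpX hpa) (hcol hm hq hqY hqa) (H := H)
    (fun v => hbound hla hlH hne hpX _) (fun v => hbound hma hmH hneY hqY _)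
  rw [Equiv.sum_comp e fun t => (X t).card] at key
  refine key.trans (Finset.sum_le_sum fun h _ => ?_)
  refine le_trans ?_ (min_card_le_card_inter (hl h) (hm h)
    (fun _ _ => mem_of_lt_staircaseSize) fun _ _ => mem_of_lt_staircaseSize)
  exact min_le_min_right _ (min_le_min (hcount hla hp hne hpX h) (hcount hma hq hneY hqY h))

/-! ### Columns and slices of exponents in three variables -/

/-- The first two coordinates of an exponent in three variables. -/
def Finsupp.column (a : Fin 3 →₀ ℕ) : ℕ × ℕ := (a 0, a 1)

theorem Finsupp.ext_column {a b : Fin 3 →₀ ℕ} (h : a.column = b.column) (h2 : a 2 = b 2) :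
    a = b := by
  ext i
  fin_cases i
  · exact congrArg Prod.fst h
  · exact congrArg Prod.snd h
  · exact h2

theorem Finsupp.le_of_column_le {a b : Fin 3 →₀ ℕ} (h : a.column ≤ b.column) (h2 : a 2 ≤ b 2) :
    a ≤ b := by
  intro i
  fin_cases i
  · exact h.1
  · exact h.2
  · exact h2

theorem Finsupp.eq_add_single_of_column_eq {a b : Fin 3 →₀ ℕ} (h : a.column = b.column)
    (h2 : a 2 ≤ b 2) : b = a + Finsupp.single 2 (b 2 - a 2) := by
  refine Finsupp.ext_column ?_ ?_
  · rw [← h]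
    simp [Finsupp.column]
  · simp only [Finsupp.add_apply, Finsupp.single_eq_same]
    omega

theorem Finsupp.column_add_single (a : Fin 3 →₀ ℕ) (c : ℕ) :
    (a + Finsupp.single 2 c).column = a.column := by
  simp [Finsupp.column]

/-- The slice at height `h` of a finite set of exponents. -/
def heightSlice (A : Finset (Fin 3 →₀ ℕ)) (h : ℕ) : Finset (ℕ × ℕ) :=
  (A.filter fun a => a 2 = h).image Finsupp.column

theorem mem_heightSlice {A : Finset (Fin 3 →₀ ℕ)} {h : ℕ} {p : ℕ × ℕ} :
    p ∈ heightSlice A h ↔ ∃ a ∈ A, a 2 = h ∧ a.column = p := by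
  simp [heightSlice, and_assoc]

theorem column_mem_heightSlice {A : Finset (Fin 3 →₀ ℕ)} {a : Fin 3 →₀ ℕ} (ha : a ∈ A) :
    a.column ∈ heightSlice A (a 2) :=
  mem_heightSlice.2 ⟨a, ha, rfl, rfl⟩

theorem exists_column_eq (p : ℕ × ℕ) (h : ℕ) : ∃ a : Fin 3 →₀ ℕ, a.column = p ∧ a 2 = h :=
  ⟨Finsupp.equivFunOnFinite.symm ![p.1, p.2, h], by simp [Finsupp.column], by simp⟩

theorem heightSlice_isLowerSet {A : Finset (Fin 3 →₀ ℕ)}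
    (hA : IsLowerSet (A : Set (Fin 3 →₀ ℕ))) (h : ℕ) :
    IsLowerSet (heightSlice A h : Set (ℕ × ℕ)) := by
  intro p q hqp hp
  obtain ⟨a, ha, rfl, rfl⟩ := mem_heightSlice.1 (Finset.mem_coe.1 hp)
  obtain ⟨b, rfl, hb2⟩ := exists_column_eq q (a 2)
  exact mem_heightSlice.2 ⟨b, hA (Finsupp.le_of_column_le hqp hb2.le) ha, hb2, rfl⟩

theorem heightSlice_antitone {A : Finset (Fin 3 →₀ ℕ)}
    (hA : IsLowerSet (A : Set (Fin 3 →₀ ℕ))) : Antitone (heightSlice A) := by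
  intro h h' hh p hp
  obtain ⟨a, ha, rfl, rfl⟩ := mem_heightSlice.1 hp
  obtain ⟨b, hbc, rfl⟩ := exists_column_eq a.column h
  exact mem_heightSlice.2 ⟨b, hA (Finsupp.le_of_column_le hbc.le hh) ha, rfl, hbc⟩

theorem sum_card_heightSlice_inter_le (A A' : Finset (Fin 3 →₀ ℕ)) (H : ℕ) :
    ∑ h ∈ Finset.range H, (heightSlice A h ∩ heightSlice A' h).card ≤ (A ∩ A').card := by
  calc ∑ h ∈ Finset.range H, (heightSlice A h ∩ heightSlice A' h).card
      ≤ ∑ h ∈ Finset.range H, ((A ∩ A').filter fun a => a 2 = h).card := by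
        refine Finset.sum_le_sum fun h _ => ?_
        refine (Finset.card_le_card fun p hp => ?_).trans
          (Finset.card_image_le (f := Finsupp.column))
        obtain ⟨hp1, hp2⟩ := Finset.mem_inter.1 hp
        obtain ⟨a, ha, ha2, rfl⟩ := mem_heightSlice.1 hp1
        obtain ⟨b, hb, hb2, hba⟩ := mem_heightSlice.1 hp2
        obtain rfl := Finsupp.ext_column hba (hb2.trans ha2.symm)
        exact Finset.mem_image_of_mem _
          (Finset.mem_filter.2 ⟨Finset.mem_inter.2 ⟨ha, hb⟩, ha2⟩)
    _ = (((Finset.range H).biUnion fun h => (A ∩ A').filter fun a => a 2 = h)).card := by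
        refine (Finset.card_biUnion fun i _ j _ hij => ?_).symm
        rw [Function.onFun, Finset.disjoint_filter]
        rintro a - rfl
        exact hij
    _ ≤ (A ∩ A').card := Finset.card_le_card
        (Finset.biUnion_subset.2 fun _ _ => Finset.filter_subset _ _)

/-- Let `A`, `A'` be finite lower sets of exponents in three variables, `B ⊆ A` and `ψ : B → A'` a
map that preserves and reflects translations. If the elements of `B` in `A` and of `ψ(B)` in `A'`
cannot be enlarged in the first two coordinates, then `|B| ≤ |A ∩ A'|`. -/
theorem card_le_card_inter_of_translation {A A' B : Finset (Fin 3 →₀ ℕ)}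
    (hA : IsLowerSet (A : Set (Fin 3 →₀ ℕ))) (hA' : IsLowerSet (A' : Set (Fin 3 →₀ ℕ)))
    (hBA : B ⊆ A) {ψ : (Fin 3 →₀ ℕ) → (Fin 3 →₀ ℕ)} (hψ : ∀ a ∈ B, ψ a ∈ A')
    (hadd : ∀ a ∈ B, ∀ b ∈ B, ∀ c, b = a + c ↔ ψ b = ψ a + c)
    (hB : ∀ a ∈ B, ∀ b ∈ A, a ≤ b → a 2 = b 2 → a = b)
    (hψB : ∀ a ∈ B, ∀ b ∈ A', ψ a ≤ b → ψ a 2 = b 2 → ψ a = b) :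
    B.card ≤ (A ∩ A').card := by
  classical
  have hψinj : ∀ a ∈ B, ∀ b ∈ B, ψ a = ψ b → a = b := fun a ha b hb h => by
    have := (hadd a ha b hb 0).2 (by rw [h, add_zero])
    rw [this, add_zero]
  -- Two exponents share a column iff one is a translate of the other along the third axis, and `ψ`
  -- preserves and reflects such translations.
  have hcol : ∀ a ∈ B, ∀ b ∈ B, a.column = b.column ↔ (ψ a).column = (ψ b).column := by
    intro a ha b hb
    constructor <;> intro h
    · rcases le_total (a 2) (b 2) with h2 | h2
      · rw [(hadd a ha b hb _).1 (Finsupp.eq_add_single_of_column_eq h h2),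
          Finsupp.column_add_single]
      · rw [(hadd b hb a ha _).1 (Finsupp.eq_add_single_of_column_eq h.symm h2),
          Finsupp.column_add_single]
    · rcases le_total (ψ a 2) (ψ b 2) with h2 | h2
      · rw [(hadd a ha b hb _).2 (Finsupp.eq_add_single_of_column_eq h h2),
          Finsupp.column_add_single]
      · rw [(hadd b hb a ha _).2 (Finsupp.eq_add_single_of_column_eq h.symm h2),
          Finsupp.column_add_single]
  have hrep : ∀ t : B.image Finsupp.column, ∃ a ∈ B, a.column = t := fun t => Finset.mem_image.1 t.2
  choose rep hrepB hrep using hrep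
  -- `F t` is the part of `B` over `t`. Its heights and those of its image under `ψ` are the two
  -- sets of equal size attached to the column.
  let F : B.image Finsupp.column → Finset (Fin 3 →₀ ℕ) := fun t => B.filter fun a => a.column = t
  have hF : ∀ {t a}, a ∈ F t ↔ a ∈ B ∧ a.column = t := fun {t a} => Finset.mem_filter
  have hFψ : ∀ {t a}, a ∈ F t → (ψ a).column = (ψ (rep t)).column := fun {t a} h =>
    (hcol a (hF.1 h).1 _ (hrepB t)).1 ((hF.1 h).2.trans (hrep t).symm)
  have hX : ∀ t, ((F t).image fun a => a 2).card = (F t).card := fun t =>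
    Finset.card_image_of_injOn fun a ha b hb hab =>
      Finsupp.ext_column ((hF.1 ha).2.trans (hF.1 hb).2.symm) hab
  have hY : ∀ t, ((F t).image fun a => ψ a 2).card = (F t).card := fun t =>
    Finset.card_image_of_injOn fun a ha b hb hab => hψinj a (hF.1 ha).1 b (hF.1 hb).1
      (Finsupp.ext_column ((hFψ ha).trans (hFψ hb).symm) hab)
  let H := (A ∪ A').sup (fun a => a 2) + 1
  have hH : ∀ A₁ ⊆ A ∪ A', heightSlice A₁ H = ∅ := by
    intro A₁ hA₁
    rw [Finset.eq_empty_iff_forall_notMem]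
    intro p hp
    obtain ⟨a, ha, ha2, -⟩ := mem_heightSlice.1 hp
    have : a 2 ≤ (A ∪ A').sup fun a => a 2 := Finset.le_sup (f := fun a => a 2) (hA₁ ha)
    omega
  calc B.card = ∑ t : B.image Finsupp.column, ((F t).image fun a => a 2).card := by
        rw [Finset.card_eq_sum_card_image Finsupp.column B, ← Finset.sum_coe_sort]
        exact Finset.sum_congr rfl fun t _ => (hX t).symm
    _ ≤ ∑ h ∈ Finset.range H, (heightSlice A h ∩ heightSlice A' h).card := by
        refine sum_card_le_sum_card_inter (p := Subtype.val)
          (q := fun t => (ψ (rep t)).column) (Y := fun t => (F t).image fun a => ψ a 2)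
          (heightSlice_isLowerSet hA) (heightSlice_isLowerSet hA') (heightSlice_antitone hA)
          (heightSlice_antitone hA') (hH A Finset.subset_union_left)
          (hH A' Finset.subset_union_right) Subtype.val_injective ?_
          (fun t => (hX t).trans (hY t).symm) ?_ ?_ ?_ ?_ ?_
        · intro t t' h
          have := (hcol _ (hrepB t) _ (hrepB t')).2 h
          rw [hrep, hrep] at this
          exact Subtype.ext this
        · exact fun t => ⟨_, Finset.mem_image_of_mem _ (hF.2 ⟨hrepB t, hrep t⟩)⟩
        · intro t h hh
          obtain ⟨a, ha, rfl⟩ := Finset.mem_image.1 hh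
          rw [← (hF.1 ha).2]
          exact column_mem_heightSlice (hBA (hF.1 ha).1)
        · intro t h hh
          obtain ⟨a, ha, rfl⟩ := Finset.mem_image.1 hh
          rw [← hFψ ha]
          exact column_mem_heightSlice (hψ a (hF.1 ha).1)
        · intro t t' h hh hh' hle
          obtain ⟨a, ha, rfl⟩ := Finset.mem_image.1 hh
          obtain ⟨b, hb, hba⟩ := Finset.mem_image.1 hh'
          refine Subtype.ext ?_
          rw [← (hF.1 ha).2, ← (hF.1 hb).2] at hle ⊢
          rw [hB a (hF.1 ha).1 b (hBA (hF.1 hb).1) (Finsupp.le_of_column_le hle hba.ge) hba.symm]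
        · intro t t' h hh hh' hle
          obtain ⟨a, ha, rfl⟩ := Finset.mem_image.1 hh
          obtain ⟨b, hb, hba⟩ := Finset.mem_image.1 hh'
          rw [← hFψ ha, ← hFψ hb] at hle
          have := hψB a (hF.1 ha).1 _ (hψ b (hF.1 hb).1) (Finsupp.le_of_column_le hle hba.ge)
            hba.symm
          have := hψinj a (hF.1 ha).1 b (hF.1 hb).1 this
          refine Subtype.ext ?_
          rw [← (hF.1 ha).2, ← (hF.1 hb).2, this]
    _ ≤ (A ∩ A').card := sum_card_heightSlice_inter_le A A' H

/-! ### Monomial ideals and their quotients -/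

section MonomialIdeal

variable {k : Type*} [Field k] {n : ℕ}

theorem mono_add (a b : Fin n →₀ ℕ) : mono k (a + b) = mono k a * mono k b := by
  simp [mono, MvPolynomial.monomial_mul]

theorem mono_single (i : Fin n) :
    mono k (Finsupp.single i 1) = (MvPolynomial.X i : MvPolynomial (Fin n) k) := rfl

theorem mono_mem_of_le {I : Ideal (MvPolynomial (Fin n) k)} {a b : Fin n →₀ ℕ} (h : a ≤ b)
    (ha : mono k a ∈ I) : mono k b ∈ I := by
  obtain ⟨c, rfl⟩ := exists_add_of_le h
  rw [mono_add]
  exact I.mul_mem_right _ ha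

theorem sum_coeff_smul_mono (p : MvPolynomial (Fin n) k) :
    ∑ a ∈ p.support, p.coeff a • mono k a = p := by
  conv_rhs => rw [p.as_sum]
  exact Finset.sum_congr rfl fun a _ => by simp [mono, MvPolynomial.smul_monomial]

/-- A polynomial belongs to a monomial ideal iff all its monomials do. -/
theorem IsMonomialIdeal.mem_iff {I : Ideal (MvPolynomial (Fin n) k)} (hI : IsMonomialIdeal I)
    {p : MvPolynomial (Fin n) k} : p ∈ I ↔ ∀ a ∈ p.support, mono k a ∈ I := by
  constructor
  · obtain ⟨s, rfl⟩ := hI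
    intro hp a ha
    obtain ⟨b, hb, hba⟩ := MvPolynomial.mem_ideal_span_monomial_image.1 hp a ha
    exact mono_mem_of_le hba (Ideal.subset_span ⟨b, hb, rfl⟩)
  · intro h
    rw [← sum_coeff_smul_mono p]
    exact I.sum_mem fun a ha => Submodule.smul_of_tower_mem I _ (h a ha)

theorem IsMonomialIdeal.sup {I J : Ideal (MvPolynomial (Fin n) k)} (hI : IsMonomialIdeal I)
    (hJ : IsMonomialIdeal J) : IsMonomialIdeal (I ⊔ J) := by
  obtain ⟨s, rfl⟩ := hI
  obtain ⟨t, rfl⟩ := hJ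
  exact ⟨s ∪ t, by rw [Set.image_union, Ideal.span_union]⟩

theorem IsMonomialIdeal.mono_mem_sup {I J : Ideal (MvPolynomial (Fin n) k)}
    (hI : IsMonomialIdeal I) (hJ : IsMonomialIdeal J) {a : Fin n →₀ ℕ} :
    mono k a ∈ I ⊔ J ↔ mono k a ∈ I ∨ mono k a ∈ J := by
  refine ⟨?_, fun h => h.elim (fun h => le_sup_left (a := I) h) fun h => le_sup_right (a := I) h⟩
  obtain ⟨s, rfl⟩ := hI
  obtain ⟨t, rfl⟩ := hJ
  rw [← Ideal.span_union, ← Set.image_union]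
  intro h
  obtain ⟨b, hb, hba⟩ := MvPolynomial.mem_ideal_span_monomial_image.1 h a
    (by classical simp [mono, MvPolynomial.support_monomial])
  exact hb.imp (fun hb => mono_mem_of_le hba (Ideal.subset_span ⟨b, hb, rfl⟩))
    fun hb => mono_mem_of_le hba (Ideal.subset_span ⟨b, hb, rfl⟩)

/-- The monomials outside a monomial ideal are linearly independent in the quotient. -/
theorem IsMonomialIdeal.linearIndependent {I : Ideal (MvPolynomial (Fin n) k)}
    (hI : IsMonomialIdeal I) :
    LinearIndependent k fun a : {a // mono k a ∉ I} => Submodule.mkQ I (mono k a.1) := by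
  classical
  rw [linearIndependent_iff']
  intro s g hg b hb
  by_contra hgb
  have hmem : ∑ a ∈ s, g a • mono k a.1 ∈ I := by
    rw [← Submodule.Quotient.mk_eq_zero, ← Submodule.mkQ_apply, map_sum, ← hg]
    rfl
  refine b.2 (hI.mem_iff.1 hmem b.1 ?_)
  rw [MvPolynomial.mem_support_iff, MvPolynomial.coeff_sum, Finset.sum_eq_single b]
  · simpa [mono] using hgb
  · intro a _ hab
    simp [mono, MvPolynomial.coeff_monomial, Subtype.val_injective.ne hab]
  · exact fun h => absurd hb h

theorem IsMonomialIdeal.eq_of_mkQ_eq {I : Ideal (MvPolynomial (Fin n) k)} (hI : IsMonomialIdeal I)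
    {a b : Fin n →₀ ℕ} (ha : mono k a ∉ I)
    (h : Submodule.mkQ I (mono k a) = Submodule.mkQ I (mono k b)) : a = b := by
  have hb : mono k b ∉ I := fun hb => ha <| by
    rwa [← Submodule.Quotient.mk_eq_zero, ← Submodule.mkQ_apply, h, Submodule.mkQ_apply,
      Submodule.Quotient.mk_eq_zero]
  exact congrArg Subtype.val (hI.linearIndependent.injective (a₁ := ⟨a, ha⟩) (a₂ := ⟨b, hb⟩) h)

theorem IsMonomialIdeal.finite_compl {I : Ideal (MvPolynomial (Fin n) k)} (hI : IsMonomialIdeal I)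
    [Module.Finite k (MvPolynomial (Fin n) k ⧸ I)] : {a | mono k a ∉ I}.Finite := by
  have := hI.linearIndependent.finite
  exact Set.finite_coe_iff.1 this

theorem IsMonomialIdeal.card_le_finrank {I : Ideal (MvPolynomial (Fin n) k)}
    (hI : IsMonomialIdeal I) [Module.Finite k (MvPolynomial (Fin n) k ⧸ I)]
    {A : Finset (Fin n →₀ ℕ)} (hA : ∀ a ∈ A, mono k a ∉ I) :
    A.card ≤ Module.finrank k (MvPolynomial (Fin n) k ⧸ I) := by
  have := (hI.linearIndependent.comp (fun a : A => ⟨a.1, hA a.1 a.2⟩) fun a b h =>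
    Subtype.ext (congrArg (fun c => c.1) h)).fintype_card_le_finrank
  rwa [Fintype.card_coe] at this

/-- The quotient of monomial ideals is spanned by the monomials in their difference. -/
theorem finrank_subquotient_le {I K : Ideal (MvPolynomial (Fin n) k)}
    (hK : IsMonomialIdeal K) {B : Finset (Fin n →₀ ℕ)}
    (hB : ∀ a, mono k a ∈ K → mono k a ∉ I → a ∈ B) :
    Module.finrank k (subquotient K I) ≤ B.card := by
  classical
  let W : Submodule k (MvPolynomial (Fin n) k ⧸ I) :=
    Submodule.span k (B.image fun a => Submodule.mkQ I (mono k a) : Finset _)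
  have hle : (subquotient K I).restrictScalars k ≤ W := by
    rintro _ ⟨p, hp, rfl⟩
    rw [← sum_coeff_smul_mono p, map_sum]
    refine W.sum_mem fun a ha => ?_
    have hsmul : Submodule.mkQ I (p.coeff a • mono k a) = p.coeff a • Submodule.mkQ I (mono k a) :=
      rfl
    rw [hsmul]
    refine W.smul_mem _ ?_
    by_cases haI : mono k a ∈ I
    · rw [Submodule.mkQ_apply, (Submodule.Quotient.mk_eq_zero I).2 haI]
      exact W.zero_mem
    · exact Submodule.subset_span (Finset.mem_coe.2
        (Finset.mem_image_of_mem _ (hB a (hK.mem_iff.1 hp a ha) haI)))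
  exact (Submodule.finrank_mono hle).trans
    ((finrank_span_finset_le_card _).trans Finset.card_image_le)

theorem mono_smul_mkQ {I : Ideal (MvPolynomial (Fin n) k)} (a b : Fin n →₀ ℕ) :
    mono k b • Submodule.mkQ I (mono k a) = Submodule.mkQ I (mono k (a + b)) := by
  rw [← map_smul, smul_eq_mul, add_comm, mono_add]

end MonomialIdeal

/-- If `x₁` and `x₂` annihilate a subquotient, its monomials cannot be enlarged in the first two
coordinates. -/
theorem eq_of_le_of_smul_eq_zero {k : Type*} [Field k] {I : Ideal (MvPolynomial (Fin 3) k)}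
    {a b : Fin 3 →₀ ℕ}
    (ha : ∀ i : Fin 3, i ≠ 2 →
      (MvPolynomial.X i : MvPolynomial (Fin 3) k) • Submodule.mkQ I (mono k a) = 0)
    (hb : mono k b ∉ I) (hab : a ≤ b) (h2 : a 2 = b 2) : a = b := by
  -- If `a i < b i`, then `x^b` is a multiple of `x_i x^a`, which lies in `I`.
  have key : ∀ i : Fin 3, i ≠ 2 → b i ≤ a i := by
    intro i hi
    by_contra! hlt
    have hmem : mono k (a + Finsupp.single i 1) ∈ I := by
      have := ha i hi
      rwa [← mono_single, mono_smul_mkQ, Submodule.mkQ_apply, Submodule.Quotient.mk_eq_zero] at this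
    refine hb (mono_mem_of_le (fun j => ?_) hmem)
    rw [Finsupp.add_apply]
    by_cases hij : i = j
    · subst hij
      rw [Finsupp.single_eq_same]
      exact hlt
    · rw [Finsupp.single_apply, if_neg hij]
      exact hab j
  ext i
  by_cases hi : i = 2
  · rw [hi, h2]
  · exact le_antisymm (hab i) (key i hi)

/-! ### The map of exponents induced by the gluing isomorphism -/

namespace GluingDatum

variable {k : Type*} [Field k] {n : ℕ} (D : GluingDatum k n)

/-- The class of a monomial of `K` in `K/I`. -/
noncomputable def monoClass {a : Fin n →₀ ℕ} (ha : mono k a ∈ D.K) : subquotient D.K D.I :=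
  ⟨Submodule.mkQ D.I (mono k a), Submodule.mem_map_of_mem ha⟩

theorem exists_φ_monoClass {a : Fin n →₀ ℕ} (ha : mono k a ∈ D.K) (haI : mono k a ∉ D.I) :
    ∃ b, mono k b ∉ D.J ∧
      (D.φ (D.monoClass ha) : MvPolynomial (Fin n) k ⧸ D.J) = Submodule.mkQ D.J (mono k b) := by
  have hne : D.monoClass ha ≠ 0 := fun h =>
    haI ((Submodule.Quotient.mk_eq_zero D.I).1 (congrArg Subtype.val h))
  obtain ⟨b, hb⟩ := D.φ_monomial _ hne ⟨a, rfl⟩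
  refine ⟨b, fun hbJ => hne ?_, hb⟩
  rw [Submodule.mkQ_apply, (Submodule.Quotient.mk_eq_zero D.J).2 hbJ] at hb
  exact D.φ.map_eq_zero_iff.1 (Subtype.ext hb)

/-- On exponents, `φ` becomes a map `ψ` that respects translations in both directions, because `φ`
is linear and injective and distinct monomials outside a monomial ideal have distinct classes. The
annihilation passes to L/J through `φ`, so maximality within slices holds on both sides. -/
theorem card_le_card_inter (D : GluingDatum k 3)
    (hD : ∀ i : Fin 3, i ≠ 2 → ∀ z : subquotient D.K D.I,
      (MvPolynomial.X i : MvPolynomial (Fin 3) k) • z = 0)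
    {A A' B : Finset (Fin 3 →₀ ℕ)} (hA : ∀ a, a ∈ A ↔ mono k a ∉ D.I)
    (hA' : ∀ a, a ∈ A' ↔ mono k a ∉ D.J) (hB : ∀ a, a ∈ B ↔ mono k a ∈ D.K ∧ mono k a ∉ D.I) :
    B.card ≤ (A ∩ A').card := by
  have hex : ∀ a : Fin 3 →₀ ℕ, ∃ b, ∀ (ha : mono k a ∈ D.K), mono k a ∉ D.I → mono k b ∉ D.J ∧
      (D.φ (D.monoClass ha) : MvPolynomial (Fin 3) k ⧸ D.J) = Submodule.mkQ D.J (mono k b) := by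
    intro a
    by_cases h : mono k a ∈ D.K ∧ mono k a ∉ D.I
    · obtain ⟨b, hb⟩ := D.exists_φ_monoClass h.1 h.2
      exact ⟨b, fun _ _ => hb⟩
    -- The value of `ψ` outside `B` is irrelevant.
    · exact ⟨0, fun h1 h2 => absurd ⟨h1, h2⟩ h⟩
  choose ψ hψ using hex
  refine card_le_card_inter_of_translation (ψ := ψ) (A := A) (A' := A')
    (fun a b hba ha => (hA b).2 fun hb => (hA a).1 ha (mono_mem_of_le hba hb))
    (fun a b hba ha => (hA' b).2 fun hb => (hA' a).1 ha (mono_mem_of_le hba hb))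
    (fun a ha => (hA a).2 ((hB a).1 ha).2)
    (fun a ha => (hA' _).2 (hψ a ((hB a).1 ha).1 ((hB a).1 ha).2).1) ?_ ?_ ?_
  · intro a ha b hb c
    obtain ⟨haK, haI⟩ := (hB a).1 ha
    obtain ⟨hbK, hbI⟩ := (hB b).1 hb
    obtain ⟨haJ, hφa⟩ := hψ a haK haI
    obtain ⟨hbJ, hφb⟩ := hψ b hbK hbI
    have hφc : (D.φ (mono k c • D.monoClass haK) : MvPolynomial (Fin 3) k ⧸ D.J) =
        Submodule.mkQ D.J (mono k (ψ a + c)) := by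
      rw [map_smul, Submodule.coe_smul, hφa, mono_smul_mkQ]
    constructor
    · rintro rfl
      refine D.monomial_J.eq_of_mkQ_eq hbJ ?_
      rw [← hφb, ← hφc]
      congr 2
      exact Subtype.ext (mono_smul_mkQ a c).symm
    · intro h
      refine D.monomial_I.eq_of_mkQ_eq hbI ?_
      rw [← mono_smul_mkQ]
      have : D.monoClass hbK = mono k c • D.monoClass haK :=
        D.φ.injective (Subtype.ext (by rw [hφb, hφc, h]))
      exact congrArg Subtype.val this
  · intro a ha b hb hab h2
    refine eq_of_le_of_smul_eq_zero (fun i hi => ?_) ((hA b).1 hb) hab h2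
    exact congrArg Subtype.val (hD i hi (D.monoClass ((hB a).1 ha).1))
  · intro a ha b hb hab h2
    refine eq_of_le_of_smul_eq_zero (fun i hi => ?_) ((hA' b).1 hb) hab h2
    rw [← (hψ a ((hB a).1 ha).1 ((hB a).1 ha).2).2, ← Submodule.coe_smul, ← map_smul, hD i hi,
      map_zero, ZeroMemClass.coe_zero]

end GluingDatum

/-! ### Dimension counts -/

theorem finite_quotient_of_le {k S : Type*} [Field k] [CommRing S] [Algebra k S] {I J : Ideal S}
    (h : I ≤ J) [Module.Finite k (S ⧸ I)] : Module.Finite k (S ⧸ J) :=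
  Module.Finite.of_surjective ((Submodule.factor h).restrictScalars k)
    (Submodule.factor_surjective h)

/-- `S/(I ∩ J)` and `S/(I + J)` together are at most as large as `S/I` and `S/J`. -/
theorem finite_quotient_inf_and_finrank_add_le {k S : Type*} [Field k] [CommRing S] [Algebra k S]
    (I J : Ideal S) [Module.Finite k (S ⧸ I)] [Module.Finite k (S ⧸ J)] :
    Module.Finite k (S ⧸ I ⊓ J) ∧
      Module.finrank k (S ⧸ I ⊓ J) + Module.finrank k (S ⧸ I ⊔ J) ≤
        Module.finrank k (S ⧸ I) + Module.finrank k (S ⧸ J) := by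
  let g : (S ⧸ I ⊓ J) →ₗ[k] (S ⧸ I) × (S ⧸ J) :=
    ((Submodule.factor (inf_le_left : I ⊓ J ≤ I)).prod
      (Submodule.factor (inf_le_right : I ⊓ J ≤ J))).restrictScalars k
  let f : (S ⧸ I) × (S ⧸ J) →ₗ[k] S ⧸ I ⊔ J :=
    ((Submodule.factor (le_sup_left : I ≤ I ⊔ J)).coprod
      (-Submodule.factor (le_sup_right : J ≤ I ⊔ J))).restrictScalars k
  have hg : Function.Injective g := by
    rw [injective_iff_map_eq_zero]
    intro u hu
    obtain ⟨p, rfl⟩ := Submodule.mkQ_surjective _ u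
    obtain ⟨h1, h2⟩ := Prod.ext_iff.1 hu
    exact (Submodule.Quotient.mk_eq_zero _).2
      ⟨(Submodule.Quotient.mk_eq_zero I).1 h1, (Submodule.Quotient.mk_eq_zero J).1 h2⟩
  have hf : Function.Surjective f := by
    intro u
    obtain ⟨p, rfl⟩ := Submodule.mkQ_surjective _ u
    exact ⟨(Submodule.mkQ I p, 0), by simp [f]⟩
  -- Of exactness in the middle only the vanishing of the composite is needed for the inequality.
  have hle : LinearMap.range g ≤ LinearMap.ker f := by
    rintro _ ⟨u, rfl⟩
    obtain ⟨p, rfl⟩ := Submodule.mkQ_surjective _ u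
    simp [f, g]
  have hfin : Module.Finite k (S ⧸ I ⊓ J) := Module.Finite.of_injective g hg
  refine ⟨hfin, ?_⟩
  have h1 := LinearMap.finrank_range_add_finrank_ker f
  rw [LinearMap.range_eq_top.2 hf, finrank_top, Module.finrank_prod] at h1
  have h2 := Submodule.finrank_mono hle
  rw [LinearMap.finrank_range_of_inj hg] at h2
  omega

namespace GluingDatum

variable {k : Type*} [Field k] {n : ℕ} (D : GluingDatum k n)

theorem finrank_add_le_finrank_M_add :
    Module.finrank k (MvPolynomial (Fin n) k ⧸ D.I) +
      Module.finrank k (MvPolynomial (Fin n) k ⧸ D.J) ≤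
        Module.finrank k D.M + Module.finrank k (subquotient D.K D.I) := by
  have := D.finite_I
  have := D.finite_J
  have : Module.Finite k (subquotient D.K D.I) :=
    Module.Finite.of_injective ((subquotient D.K D.I).subtype.restrictScalars k)
      Subtype.val_injective
  let f : ((MvPolynomial (Fin n) k ⧸ D.I) × (MvPolynomial (Fin n) k ⧸ D.J)) →ₗ[k] D.M :=
    D.relations.mkQ.restrictScalars k
  let g : subquotient D.K D.I →ₗ[k]
      ((MvPolynomial (Fin n) k ⧸ D.I) × (MvPolynomial (Fin n) k ⧸ D.J)) :=
    ((subquotient D.K D.I).subtype.prod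
      (-((subquotient D.L D.J).subtype ∘ₗ D.φ.toLinearMap))).restrictScalars k
  have hf : Function.Surjective f := D.relations.mkQ_surjective
  have hle : LinearMap.ker f ≤ LinearMap.range g := by
    intro u hu
    exact (Submodule.Quotient.mk_eq_zero D.relations).1 hu
  have h1 := LinearMap.finrank_range_add_finrank_ker f
  rw [LinearMap.range_eq_top.2 hf, finrank_top, Module.finrank_prod] at h1
  have h2 := (Submodule.finrank_mono hle).trans (LinearMap.finrank_range_le g)
  omega

theorem lsmul_eq_zero {p : MvPolynomial (Fin n) k} (hI : p ∈ D.I) (hJ : p ∈ D.J) :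
    Algebra.lsmul k k D.M p = 0 := by
  refine LinearMap.ext fun m => ?_
  obtain ⟨⟨u, v⟩, rfl⟩ := Submodule.mkQ_surjective _ m
  obtain ⟨u, rfl⟩ := Submodule.mkQ_surjective _ u
  obtain ⟨v, rfl⟩ := Submodule.mkQ_surjective _ v
  have hu : p • Submodule.mkQ D.I u = 0 := by
    rw [← map_smul]
    exact (Submodule.Quotient.mk_eq_zero D.I).2 (D.I.mul_mem_right u hI)
  have hv : p • Submodule.mkQ D.J v = 0 := by
    rw [← map_smul]
    exact (Submodule.Quotient.mk_eq_zero D.J).2 (D.J.mul_mem_right v hJ)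
  change p • D.relations.mkQ _ = 0
  rw [← map_smul, Prod.smul_mk, hu, hv, Prod.mk_zero_zero, map_zero]

/-- The algebra generated by the associated matrices is a quotient of `S/(I ∩ J)`. -/
theorem finrank_adjoin_le
    {A : Fin n → Matrix (Fin (Module.finrank k D.M)) (Fin (Module.finrank k D.M)) k}
    (hA : D.IsAssociated A) [Module.Finite k (MvPolynomial (Fin n) k ⧸ D.I ⊓ D.J)] :
    Module.finrank k (Algebra.adjoin k (Set.range A)) ≤
      Module.finrank k (MvPolynomial (Fin n) k ⧸ D.I ⊓ D.J) := by
  obtain ⟨b, -, hb⟩ := hA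
  let f : MvPolynomial (Fin n) k →ₐ[k]
      Matrix (Fin (Module.finrank k D.M)) (Fin (Module.finrank k D.M)) k :=
    (LinearMap.toMatrixAlgEquiv b).toAlgHom.comp (Algebra.lsmul k k D.M)
  have hfA : Algebra.adjoin k (Set.range A) = f.range := by
    have hrange : Set.range A = f '' Set.range MvPolynomial.X := by
      rw [← Set.range_comp]
      exact congrArg Set.range (funext hb)
    rw [hrange, ← AlgHom.map_adjoin, MvPolynomial.adjoin_range_X, Algebra.map_top]
  have hker : ∀ p ∈ D.I ⊓ D.J, f p = 0 := fun p hp => by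
    change LinearMap.toMatrixAlgEquiv b (Algebra.lsmul k k D.M p) = 0
    rw [D.lsmul_eq_zero hp.1 hp.2, map_zero]
  let g : (MvPolynomial (Fin n) k ⧸ D.I ⊓ D.J) →ₐ[k]
      Matrix (Fin (Module.finrank k D.M)) (Fin (Module.finrank k D.M)) k :=
    Ideal.Quotient.liftₐ (D.I ⊓ D.J) f hker
  rw [hfA]
  have hle : Subalgebra.toSubmodule f.range ≤ LinearMap.range g.toLinearMap := by
    rintro _ ⟨p, rfl⟩
    exact ⟨Ideal.Quotient.mk _ p, rfl⟩
  exact (Submodule.finrank_mono hle).trans (LinearMap.finrank_range_le _)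

/-- The monomials outside I + J are exactly those outside both I and J, so the count |B| ≤ |A ∩ A'|
turns into dimensions. -/
theorem finrank_subquotient_le_finrank_quotient_sup (D : GluingDatum k 3)
    (hD : ∀ i : Fin 3, i ≠ 2 → ∀ z : subquotient D.K D.I,
      (MvPolynomial.X i : MvPolynomial (Fin 3) k) • z = 0) :
    Module.finrank k (subquotient D.K D.I) ≤
      Module.finrank k (MvPolynomial (Fin 3) k ⧸ D.I ⊔ D.J) := by
  classical
  have := D.finite_I
  have := D.finite_J
  have := finite_quotient_of_le (k := k) (le_sup_left : D.I ≤ D.I ⊔ D.J)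
  obtain ⟨A, hA⟩ : ∃ A : Finset (Fin 3 →₀ ℕ), ∀ a, a ∈ A ↔ mono k a ∉ D.I :=
    ⟨D.monomial_I.finite_compl.toFinset, fun a => Set.Finite.mem_toFinset _⟩
  obtain ⟨A', hA'⟩ : ∃ A : Finset (Fin 3 →₀ ℕ), ∀ a, a ∈ A ↔ mono k a ∉ D.J :=
    ⟨D.monomial_J.finite_compl.toFinset, fun a => Set.Finite.mem_toFinset _⟩
  obtain ⟨B, hB⟩ : ∃ B : Finset (Fin 3 →₀ ℕ), ∀ a, a ∈ B ↔ mono k a ∈ D.K ∧ mono k a ∉ D.I :=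
    ⟨A.filter fun a => mono k a ∈ D.K, fun a => by rw [Finset.mem_filter, hA, and_comm]⟩
  calc Module.finrank k (subquotient D.K D.I) ≤ B.card :=
        finrank_subquotient_le D.monomial_K fun a ha haI => (hB a).2 ⟨ha, haI⟩
    _ ≤ (A ∩ A').card := D.card_le_card_inter hD hA hA' hB
    _ ≤ _ := (D.monomial_I.sup D.monomial_J).card_le_finrank fun a ha => by
        rw [D.monomial_I.mono_mem_sup D.monomial_J, not_or, ← hA, ← hA']
        exact Finset.mem_inter.1 ha

/-- Gluing along a module that is annihilated by `x₁` and `x₂`. -/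
theorem finrank_adjoin_le_finrank_M (D : GluingDatum k 3)
    (hD : ∀ i : Fin 3, i ≠ 2 → ∀ z : subquotient D.K D.I,
      (MvPolynomial.X i : MvPolynomial (Fin 3) k) • z = 0)
    {A : Fin 3 → Matrix (Fin (Module.finrank k D.M)) (Fin (Module.finrank k D.M)) k}
    (hA : D.IsAssociated A) :
    Module.finrank k (Algebra.adjoin k (Set.range A)) ≤ Module.finrank k D.M := by
  have := D.finite_I
  have := D.finite_J
  obtain ⟨hfin, hinf⟩ := finite_quotient_inf_and_finrank_add_le (k := k) D.I D.J
  have h1 := D.finrank_adjoin_le hA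
  have h2 := D.finrank_add_le_finrank_M_add
  have h3 := D.finrank_subquotient_le_finrank_quotient_sup hD
  omega

end GluingDatum

theorem X_smul_directSum_eq_zero {k : Type*} [Field k] {ι : Type*} (n : ι → ℕ) {j : Fin 3}
    (hj : j ≠ 2)
    (z : ⨁ i, MvPolynomial (Fin 3) k ⧸
      (Ideal.span {MvPolynomial.X 0, MvPolynomial.X 1, MvPolynomial.X 2 ^ n i} :
        Ideal (MvPolynomial (Fin 3) k))) :
    (MvPolynomial.X j : MvPolynomial (Fin 3) k) • z = 0 := by
  refine DFinsupp.ext fun i => ?_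
  obtain ⟨p, hp⟩ := Submodule.mkQ_surjective _ (z i)
  change (MvPolynomial.X j : MvPolynomial (Fin 3) k) • z i = 0
  rw [← hp, ← map_smul]
  refine (Submodule.Quotient.mk_eq_zero _).2 (Ideal.mul_mem_right p _ (Ideal.subset_span ?_))
  fin_cases j
  · exact Or.inl rfl
  · exact Or.inr (Or.inl rfl)
  · exact absurd rfl hj

theorem mainTheorem1 {k : Type*} [Field k] {ι : Type*} (n : ι → ℕ) :
    CombinatorialGerstenhaberHolds k 3
      (⨁ i, MvPolynomial (Fin 3) k ⧸
        (Ideal.span {MvPolynomial.X 0, MvPolynomial.X 1, MvPolynomial.X 2 ^ n i} :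
          Ideal (MvPolynomial (Fin 3) k))) := by
  rintro D ⟨e⟩ A hA
  refine D.finrank_adjoin_le_finrank_M (fun j hj z => e.injective ?_) hA
  rw [map_smul, map_zero, X_smul_directSum_eq_zero n hj]
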